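/- Let $\eta_3\in(-2,2)$ and let $\varphi(t,x)$ denote the (local) flow on $\mathbb{R}^4$ of $$x_1'=x_2,\quad x_2'=x_3,\quad x_3'=x_4,\quad x_4'=-x_1+\eta_3x_3+x_1^2 ,$$ which has the first integral $H(x)=\tfrac12x_1^2-\tfrac13x_1^3-\tfrac{\eta_3}{2}x_2^2+x_2x_4-\tfrac12x_3^2$ and a bifocal equilibrium at the origin $\mathcal O$. Let the local unstable manifold of $\mathcal O$, i.e. the set of points whose backward orbit exists for all $t\le 0$, stays in a given open neighbourhood $U$ of $\mathcal O$ and tends to $\mathcal O$ as $t\to-\infty$, be written as the graph $\{x_3=a(x_1,x_2),\ x_4=b(x_1,x_2),\ (x_1,x_2)\in V\}$ of functions $a,b$ real analytic on an open neighbourhood $V$ of $(0,0)$. For $r^*>0$ and $\theta\in\,]0,2\pi]$ put $$\sigma(\theta)=\bigl(x_1,x_2,a(x_1,x_2),b(x_1,x_2)\bigr),\qquad x_1=r^*\cos\theta,\ x_2=r^*\sin\theta .$$ Let $S=\{x_2=0\}$ and $C=S\cap\{H=0\}$, and let $C_1,C_2,C_3,C_4$ be the sets of points of $C$ with, respectively,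 $(x_1<0,x_3>0)$, $(x_1>0,x_3>0)$, $(x_1>0,x_3<0)$, $(x_1<0,x_3<0)$. For a point $p$, let $t_S(p)>0$ be the time, if it exists, such that $\varphi(t_S(p),p)\in S$ and $\varphi(t,p)\notin S$ for all $t\in\,]0,t_S(p)[$. When the circle of radius $r^*$ centred at $(0,0)$ is contained in $V$, let $\Sigma^{u,+}_1$ (resp. $\Sigma^{u,-}_1$) be the set of the points $\varphi(t_S(p),p)$ with $p\in\sigma(]0,\pi])$ (resp. $p\in\sigma(]\pi,2\pi])$), let $\Sigma^{u,\pm}_{k+1}$ be the set of the points $\varphi(t_S(p),p)$ with $p\in\Sigma^{u,\pm}_k$, in each case for those $p$ for which $t_S(p)$ exists, and let $\Sigma^u_k=\Sigma^{u,+}_k\cup\Sigma^{u,-}_k$ for $k\ge1$. Then: 1. If $r^*$ is small enough, then $\sigma(\pi)\in C_1$ and $\sigma(2\pi)\in C_3$. 2. If $r^*$ is small enough, then $\varphi(t,\sigma(\pi))\in\{x_2>0\}$ and $\varphi(t,\sigma(2\pi))\in\{x_2<0\}$ for all small enough $t>0$. 3. Let $\bar x\in\{H=0\}$ with $\bar x_2>0$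 (resp. $\bar x_2<0$), and assume that $\tau=t_S(\bar x)$ exists. Then $\varphi(\tau,\bar x)\in\overline{C_3\cup C_4}$ (resp. $\overline{C_1\cup C_2}$). 4. Let $k\ge1$ and let $\bar x\in(C_1\cup C_2)\cap\Sigma^u_k$ (resp. $\bar x\in(C_3\cup C_4)\cap\Sigma^u_k$), and assume that $t_S(\bar x)$ exists, with $\bar x^*=\varphi(t_S(\bar x),\bar x)\in\Sigma^u_{k+1}$. Then $\bar x^*\in\overline{C_3\cup C_4}$ (resp. $\overline{C_1\cup C_2}$). -/

import Mathlib

open Set Filter Topology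

noncomputable section

/-! Points of `ℝ⁴` are functions `Fin 4 → ℝ`; the coordinates `x₁, x₂, x₃, x₄` are
`x 0, x 1, x 2, x 3`. -/

namespace BifocalSystem

/-- The vector field `(x₂, x₃, x₄, -x₁ + η x₃ + x₁²)`. -/
def field (η : ℝ) (x : Fin 4 → ℝ) : Fin 4 → ℝ :=
  ![x 1, x 2, x 3, -x 0 + η * x 2 + x 0 ^ 2]

/-- The first integral `H`. -/
def energy (η : ℝ) (x : Fin 4 → ℝ) : ℝ :=
  x 0 ^ 2 / 2 - x 0 ^ 3 / 3 - η / 2 * x 1 ^ 2 + x 1 * x 3 - x 2 ^ 2 / 2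

/-- The maximal interval of existence of the solution starting at `x`: the times `t` such that
a solution with value `x` at time `0` exists on the whole interval between `0` and `t`. -/
def flowDomain (η : ℝ) (x : Fin 4 → ℝ) : Set ℝ :=
  {t | ∃ γ : ℝ → Fin 4 → ℝ, γ 0 = x ∧ IsIntegralCurveOn γ (fun _ => field η) (uIcc 0 t)}

open Classical in
/-- The (local) flow `φ(t, x)`; its value is meaningful for `t ∈ flowDomain η x`
(see `flow_eq`), and is `x` by convention otherwise. -/
def flow (η : ℝ) (t : ℝ) (x : Fin 4 → ℝ) : Fin 4 → ℝ :=
  if h : t ∈ flowDomain η x then h.choose t else x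

theorem contDiff_field (η : ℝ) : ContDiff ℝ 1 (field η) := by
  rw [contDiff_pi]
  intro i
  fin_cases i <;> simp [field] <;> fun_prop

/-- Uniqueness of solutions. -/
theorem solution_unique (η t : ℝ) (f g : ℝ → Fin 4 → ℝ) (h0 : f 0 = g 0)
    (hf : IsIntegralCurveOn f (fun _ => field η) (uIcc 0 t))
    (hg : IsIntegralCurveOn g (fun _ => field η) (uIcc 0 t)) :
    EqOn f g (uIcc 0 t) := by
  have hfc : ContinuousOn f (uIcc 0 t) := fun s hs => (hf s hs).continuousWithinAt
  have hgc : ContinuousOn g (uIcc 0 t) := fun s hs => (hg s hs).continuousWithinAt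
  have hcomp : IsCompact (f '' uIcc 0 t ∪ g '' uIcc 0 t) :=
    (isCompact_uIcc.image_of_continuousOn hfc).union (isCompact_uIcc.image_of_continuousOn hgc)
  obtain ⟨K, hK⟩ := LocallyLipschitzOn.exists_lipschitzOnWith_of_compact hcomp
    ((contDiff_field η).locallyLipschitz.locallyLipschitzOn)
  have hfs : ∀ s ∈ uIcc 0 t, f s ∈ f '' uIcc 0 t ∪ g '' uIcc 0 t :=
    fun s hs => Or.inl ⟨s, hs, rfl⟩
  have hgs : ∀ s ∈ uIcc 0 t, g s ∈ f '' uIcc 0 t ∪ g '' uIcc 0 t :=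
    fun s hs => Or.inr ⟨s, hs, rfl⟩
  rcases le_total 0 t with ht | ht
  · rw [uIcc_of_le ht] at hf hg hfc hgc hfs hgs hK ⊢
    exact ODE_solution_unique_of_mem_Icc_right (v := fun _ => field η) (fun _ _ => hK) hfc
      (fun s hs => (hf s (Ico_subset_Icc_self hs)).mono_of_mem_nhdsWithin
        (Icc_mem_nhdsGE_of_mem hs))
      (fun s hs => hfs s (Ico_subset_Icc_self hs)) hgc
      (fun s hs => (hg s (Ico_subset_Icc_self hs)).mono_of_mem_nhdsWithin
        (Icc_mem_nhdsGE_of_mem hs))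
      (fun s hs => hgs s (Ico_subset_Icc_self hs)) h0
  · rw [uIcc_of_ge ht] at hf hg hfc hgc hfs hgs hK ⊢
    exact ODE_solution_unique_of_mem_Icc_left (v := fun _ => field η) (fun _ _ => hK) hfc
      (fun s hs => (hf s (Ioc_subset_Icc_self hs)).mono_of_mem_nhdsWithin
        (Icc_mem_nhdsLE_of_mem hs))
      (fun s hs => hfs s (Ioc_subset_Icc_self hs)) hgc
      (fun s hs => (hg s (Ioc_subset_Icc_self hs)).mono_of_mem_nhdsWithin
        (Icc_mem_nhdsLE_of_mem hs))
      (fun s hs => hgs s (Ioc_subset_Icc_self hs)) h0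

/-- The flow is well defined: it agrees with every solution through `x`. -/
theorem flow_eq (η t : ℝ) (γ : ℝ → Fin 4 → ℝ)
    (hγ : IsIntegralCurveOn γ (fun _ => field η) (uIcc 0 t)) :
    flow η t (γ 0) = γ t := by
  have h : t ∈ flowDomain η (γ 0) := ⟨γ, rfl, hγ⟩
  rw [flow, dif_pos h]
  exact solution_unique η t _ _ h.choose_spec.1 h.choose_spec.2 hγ right_mem_uIcc

/-- The local unstable manifold of the origin relative to a neighbourhood `U`: the points
whose backward orbit exists for all negative times, stays in `U` and converges to the origin. -/
def localUnstable (η : ℝ) (U : Set (Fin 4 → ℝ)) : Set (Fin 4 → ℝ) :=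
  {p | (∀ t ≤ 0, t ∈ flowDomain η p ∧ flow η t p ∈ U) ∧
    Tendsto (fun t => flow η t p) atBot (𝓝 0)}

/-- `a` and `b` are real analytic on the open neighbourhood `V` of `(0, 0)`, and their graph
`x₃ = a(x₁, x₂)`, `x₄ = b(x₁, x₂)`, `(x₁, x₂) ∈ V`, is the local unstable manifold of the
origin (relative to the open neighbourhood `U` of the origin). -/
structure IsLocalUnstableGraph (η : ℝ) (U : Set (Fin 4 → ℝ)) (V : Set (ℝ × ℝ))
    (a b : ℝ × ℝ → ℝ) : Prop where
  isOpen_U : IsOpen U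
  zero_mem_U : (0 : Fin 4 → ℝ) ∈ U
  isOpen_V : IsOpen V
  zero_mem_V : ((0, 0) : ℝ × ℝ) ∈ V
  analytic_a : AnalyticOnNhd ℝ a V
  analytic_b : AnalyticOnNhd ℝ b V
  localUnstable_eq : localUnstable η U =
    {p | (p 0, p 1) ∈ V ∧ p 2 = a (p 0, p 1) ∧ p 3 = b (p 0, p 1)}

/-- The parametrization `σ(θ)` of the closed curve on the graph of `(a, b)` over the circle of
radius `r` in the `(x₁, x₂)`-plane. -/
def sigma (a b : ℝ × ℝ → ℝ) (r θ : ℝ) : Fin 4 → ℝ :=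
  ![r * Real.cos θ, r * Real.sin θ,
    a (r * Real.cos θ, r * Real.sin θ), b (r * Real.cos θ, r * Real.sin θ)]

/-- The cross section `S = {x₂ = 0}`. -/
def crossSection : Set (Fin 4 → ℝ) := {x | x 1 = 0}

/-- The loop cylinder `C = S ∩ {H = 0}`. -/
def cylinder (η : ℝ) : Set (Fin 4 → ℝ) := crossSection ∩ {x | energy η x = 0}

/-- The region `C₁`. -/
def C1 (η : ℝ) : Set (Fin 4 → ℝ) := {x | x ∈ cylinder η ∧ x 0 < 0 ∧ 0 < x 2}

/-- The region `C₂`. -/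
def C2 (η : ℝ) : Set (Fin 4 → ℝ) := {x | x ∈ cylinder η ∧ 0 < x 0 ∧ 0 < x 2}

/-- The region `C₃`. -/
def C3 (η : ℝ) : Set (Fin 4 → ℝ) := {x | x ∈ cylinder η ∧ 0 < x 0 ∧ x 2 < 0}

/-- The region `C₄`. -/
def C4 (η : ℝ) : Set (Fin 4 → ℝ) := {x | x ∈ cylinder η ∧ x 0 < 0 ∧ x 2 < 0}

/-- `τ > 0` is the first positive time at which the orbit of `x` meets the cross section. -/
def IsFirstHit (η : ℝ) (x : Fin 4 → ℝ) (τ : ℝ) : Prop :=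
  0 < τ ∧ τ ∈ flowDomain η x ∧ flow η τ x ∈ crossSection ∧
    ∀ t ∈ Ioo 0 τ, flow η t x ∉ crossSection

/-- The set of first intersections with the cross section of the forward orbits of points
of `A`. -/
def firstHits (η : ℝ) (A : Set (Fin 4 → ℝ)) : Set (Fin 4 → ℝ) :=
  {q | ∃ p ∈ A, ∃ τ, IsFirstHit η p τ ∧ q = flow η τ p}

/-- The arc `D^{u,+}`. -/
def arcPlus (a b : ℝ × ℝ → ℝ) (r : ℝ) : Set (Fin 4 → ℝ) :=
  sigma a b r '' Ioc 0 Real.pi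

/-- The arc `D^{u,-}`. -/
def arcMinus (a b : ℝ × ℝ → ℝ) (r : ℝ) : Set (Fin 4 → ℝ) :=
  sigma a b r '' Ioc Real.pi (2 * Real.pi)

/-- `Σ^{u,+}_k` for `k ≥ 1`; the value at `k = 0` is the initial arc `D^{u,+}`. -/
def sectionPlus (η : ℝ) (a b : ℝ × ℝ → ℝ) (r : ℝ) : ℕ → Set (Fin 4 → ℝ)
  | 0 => arcPlus a b r
  | k + 1 => firstHits η (sectionPlus η a b r k)

/-- `Σ^{u,-}_k` for `k ≥ 1`; the value at `k = 0` is the initial arc `D^{u,-}`. -/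
def sectionMinus (η : ℝ) (a b : ℝ × ℝ → ℝ) (r : ℝ) : ℕ → Set (Fin 4 → ℝ)
  | 0 => arcMinus a b r
  | k + 1 => firstHits η (sectionMinus η a b r k)

/-- `Σ^u_k = Σ^{u,+}_k ∪ Σ^{u,-}_k`, for `k ≥ 1`. -/
def sectionAll (η : ℝ) (a b : ℝ × ℝ → ℝ) (r : ℝ) (k : ℕ) : Set (Fin 4 → ℝ) :=
  sectionPlus η a b r k ∪ sectionMinus η a b r k

end BifocalSystem

end

namespace BifocalSystem

variable {η : ℝ}

/-! Two mechanisms carry the result. The crossing statements follow from x₂' = x₃: an orbit that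
arrives at `crossSection` from {x₂ > 0} does so with x₃ ≤ 0, and symmetrically
(`IsFirstHit.mul_flow_nonpos`). Since H is conserved, the hit lies on `cylinder`, where x₃² = x₁²(1
- 2x₁/3); points with x₃ = 0 have x₁ = 0 or x₁ = 3/2 and are limits of points of C₂ and of C₃,
whence the closures. A factor c = ±1 treats both sides at once.

The position of σ(π) and σ(2π) depends on the slope of `a` along the x₁-axis. H vanishes on the
local unstable manifold, and backward invariance makes the field tangent to the graph. Linearizing
the tangency equations at the origin gives polynomial equations for Da(0,0), and |η| < 2 leaves only
∂a/∂x₁ = -1 (`IsLocalUnstableGraph.fderiv_a`). Hence a(±r, 0) has the sign of ∓r for small r. -/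

/-! ### Solutions and the first integral. -/

/-- A time in the domain of the flow comes with a solution computing the flow up to it. -/
theorem exists_solution {t : ℝ} {x : Fin 4 → ℝ} (ht : t ∈ flowDomain η x) :
    ∃ γ : ℝ → Fin 4 → ℝ, γ 0 = x ∧ IsIntegralCurveOn γ (fun _ => field η) (uIcc 0 t) ∧
      ∀ s ∈ uIcc 0 t, flow η s x = γ s := by
  obtain ⟨γ, h0, hγ⟩ := ht
  refine ⟨γ, h0, hγ, fun s hs => ?_⟩
  rw [← h0]
  exact flow_eq η s γ (hγ.mono (uIcc_subset_uIcc_left hs))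

theorem IsIntegralCurveOn.hasDerivWithinAt_coord {γ : ℝ → Fin 4 → ℝ} {s : Set ℝ} {t : ℝ}
    (hγ : IsIntegralCurveOn γ (fun _ => field η) s) (ht : t ∈ s) (i : Fin 4) :
    HasDerivWithinAt (fun u => γ u i) (field η (γ t) i) s t :=
  (hasDerivWithinAt_pi.1 (hγ t ht)) i

theorem exists_local_solution (η : ℝ) (x : Fin 4 → ℝ) :
    ∃ ε > 0, ∃ γ : ℝ → Fin 4 → ℝ, γ 0 = x ∧
      IsIntegralCurveOn γ (fun _ => field η) (Ioo (-ε) ε) := by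
  obtain ⟨γ, h0, ε, hε, hγ⟩ := ContDiffAt.exists_forall_mem_closedBall_exists_eq_forall_mem_Ioo_hasDerivAt₀
    (contDiff_field η).contDiffAt (x₀ := x) (0 : ℝ)
  simp only [zero_sub, zero_add] at hγ
  exact ⟨ε, hε, γ, h0, fun t ht => (hγ t ht).hasDerivWithinAt⟩

/-- `H` is constant along solutions. -/
theorem energy_flow {t : ℝ} {x : Fin 4 → ℝ} (ht : t ∈ flowDomain η x) :
    energy η (flow η t x) = energy η x := by
  obtain ⟨γ, h0, hγ, hf⟩ := exists_solution ht
  have hd : ∀ s ∈ uIcc 0 t, HasDerivWithinAt (fun s => energy η (γ s)) 0 (uIcc 0 t) s := by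
    intro s hs
    have h0 := IsIntegralCurveOn.hasDerivWithinAt_coord hγ hs 0
    have h1 := IsIntegralCurveOn.hasDerivWithinAt_coord hγ hs 1
    have h2 := IsIntegralCurveOn.hasDerivWithinAt_coord hγ hs 2
    have h3 := IsIntegralCurveOn.hasDerivWithinAt_coord hγ hs 3
    have h := ((((h0.pow 2).div_const 2).sub ((h0.pow 3).div_const 3)).sub
      ((h1.pow 2).const_mul (η / 2))).add (h1.mul h3) |>.sub ((h2.pow 2).div_const 2)
    convert! h using 1
    simp [field]
    ring
  have h := (convex_uIcc (0 : ℝ) t).norm_image_sub_le_of_norm_hasDerivWithin_le (C := 0) hd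
    (by simp) left_mem_uIcc right_mem_uIcc
  rw [zero_mul, norm_le_zero_iff, sub_eq_zero] at h
  rw [hf t right_mem_uIcc, h, h0]

/-! ### Sign of x₂ along orbits and first hits. -/

theorem HasDerivWithinAt.eventually_pos_right {f : ℝ → ℝ} {f' a : ℝ}
    (hf : HasDerivWithinAt f f' (Ioi a) a) (ha : f a = 0) (hf' : 0 < f') :
    ∀ᶠ t in 𝓝[>] a, 0 < f t := by
  have h := (hasDerivWithinAt_iff_tendsto_slope' (notMem_Ioi.2 le_rfl)).1 hf
  filter_upwards [h.eventually_const_lt hf', self_mem_nhdsWithin] with t ht hat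
  rw [slope_def_field, ha, sub_zero] at ht
  exact (div_pos_iff_of_pos_right (sub_pos.2 hat)).1 ht

theorem HasDerivWithinAt.eventually_neg_left {f : ℝ → ℝ} {f' a : ℝ}
    (hf : HasDerivWithinAt f f' (Iio a) a) (ha : f a = 0) (hf' : 0 < f') :
    ∀ᶠ t in 𝓝[<] a, f t < 0 := by
  have h := (hasDerivWithinAt_iff_tendsto_slope' (notMem_Iio.2 le_rfl)).1 hf
  filter_upwards [h.eventually_const_lt hf', self_mem_nhdsWithin] with t ht hat
  rw [slope_def_field, ha, sub_zero] at ht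
  have hneg : t - a < 0 := sub_neg.2 hat
  by_contra! hc
  exact absurd ht (not_lt.2 (div_nonpos_of_nonneg_of_nonpos hc hneg.le))

/-- The orbit of a point of the section with `c x₃ > 0` enters `{c x₂ > 0}`. -/
theorem exists_forall_Ioo_pos_flow {x : Fin 4 → ℝ} {c : ℝ} (hx : x 1 = 0) (hc : 0 < c * x 2) :
    ∃ ε > 0, ∀ t ∈ Ioo 0 ε, t ∈ flowDomain η x ∧ 0 < c * flow η t x 1 := by
  obtain ⟨δ, hδ, γ, rfl, hγ⟩ := exists_local_solution η x
  have hd := ((IsIntegralCurveOn.hasDerivWithinAt_coord hγ (t := 0) (by simpa) 1).const_mul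
    c).mono_of_mem_nhdsWithin (s := Ioi 0)
    (mem_nhdsWithin_of_mem_nhds (Ioo_mem_nhds (by simpa) hδ))
  have h := HasDerivWithinAt.eventually_pos_right hd (by simp [hx]) (by simpa [field] using hc)
  obtain ⟨ε, hε, hsub⟩ := mem_nhdsGT_iff_exists_Ioo_subset.1 h
  refine ⟨min δ ε, lt_min hδ hε, fun t ht => ?_⟩
  have hγt : IsIntegralCurveOn γ (fun _ => field η) (uIcc 0 t) := by
    refine hγ.mono ?_
    rw [uIcc_of_le ht.1.le]
    exact fun s hs => ⟨by linarith [hs.1], hs.2.trans_lt (ht.2.trans_le (min_le_left _ _))⟩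
  refine ⟨⟨γ, rfl, hγt⟩, ?_⟩
  rw [flow_eq η t γ hγt]
  exact hsub ⟨ht.1, ht.2.trans_le (min_le_right _ _)⟩

/-- An orbit in `{c x₂ > 0}` reaches the section in `{c x₃ ≤ 0}`. -/
theorem IsFirstHit.mul_flow_nonpos {x : Fin 4 → ℝ} {τ c s : ℝ} (h : IsFirstHit η x τ)
    (hs : s ∈ Ioo 0 τ) (hpos : 0 < c * flow η s x 1) : c * flow η τ x 2 ≤ 0 := by
  obtain ⟨hτ, hdom, hmem, hout⟩ := h
  obtain ⟨γ, -, hγ, hf⟩ := exists_solution hdom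
  rw [uIcc_of_le hτ.le] at hγ hf
  have hc : c ≠ 0 := by rintro rfl; simp at hpos
  have hne : ∀ t ∈ Ioo 0 τ, c * γ t 1 ≠ 0 := fun t ht h0 => by
    refine hout t ht ?_
    rw [hf t (Ioo_subset_Icc_self ht)]
    exact (mul_eq_zero.1 h0).resolve_left hc
  have hcont : ContinuousOn (fun t => c * γ t 1) (Ioo 0 τ) := fun t ht =>
    ((IsIntegralCurveOn.hasDerivWithinAt_coord hγ (Ioo_subset_Icc_self ht)
      1).continuousWithinAt.mono Ioo_subset_Icc_self).const_mul c
  rw [hf s (Ioo_subset_Icc_self hs)] at hpos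
  -- x₂ has no zero before the first hit, so its sign at time s persists on the whole interval.
  have hall : ∀ t ∈ Ioo 0 τ, 0 < c * γ t 1 := fun t ht => by
    by_contra! hle
    obtain ⟨u, hu, hu0⟩ := isPreconnected_Ioo.intermediate_value ht hs hcont ⟨hle, hpos.le⟩
    exact hne u hu hu0
  have hτ' : τ ∈ Icc 0 τ := right_mem_Icc.2 hτ.le
  rw [hf τ hτ'] at hmem ⊢
  -- Otherwise c x₂ vanishes at τ with positive derivative, so it is negative just before τ.
  by_contra! hgt
  have hd := ((IsIntegralCurveOn.hasDerivWithinAt_coord hγ hτ' 1).const_mul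
    c).mono_of_mem_nhdsWithin (s := Iio τ) (Icc_mem_nhdsLT_of_mem ⟨hτ, le_rfl⟩)
  have hneg := HasDerivWithinAt.eventually_neg_left hd (by simp [show γ τ 1 = 0 from hmem])
    (by simpa [field] using hgt)
  obtain ⟨t, ht1, ht2⟩ := (hneg.and (Ioo_mem_nhdsLT hτ)).exists
  exact lt_asymm (hall t ht2) ht1

theorem IsFirstHit.flow_mem_cylinder {x : Fin 4 → ℝ} {τ : ℝ} (h : IsFirstHit η x τ)
    (hx : energy η x = 0) : flow η τ x ∈ cylinder η :=
  ⟨h.2.2.1, (energy_flow h.2.1).trans hx⟩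

theorem IsFirstHit.mul_flow_nonpos_of_pos {x : Fin 4 → ℝ} {τ c : ℝ} (h : IsFirstHit η x τ)
    (hx : 0 < c * x 1) : c * flow η τ x 2 ≤ 0 := by
  obtain ⟨γ, h0, hγ, hf⟩ := exists_solution h.2.1
  rw [uIcc_of_le h.1.le] at hγ hf
  have hcont := ((IsIntegralCurveOn.hasDerivWithinAt_coord hγ (left_mem_Icc.2 h.1.le)
    1).continuousWithinAt.const_mul c).mono_of_mem_nhdsWithin (s := Ioi 0)
      (Icc_mem_nhdsGT_of_mem ⟨le_rfl, h.1⟩)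
  have hev := hcont.eventually_const_lt (u := 0) (by simpa only [h0] using hx)
  obtain ⟨t, ht1, ht2⟩ := (hev.and (Ioo_mem_nhdsGT h.1)).exists
  exact h.mul_flow_nonpos ht2 (by rwa [hf t (Ioo_subset_Icc_self ht2)])

theorem IsFirstHit.mul_flow_nonpos_of_mem {x : Fin 4 → ℝ} {τ c : ℝ} (h : IsFirstHit η x τ)
    (hx : x 1 = 0) (hc : 0 < c * x 2) : c * flow η τ x 2 ≤ 0 := by
  obtain ⟨ε, hε, hpos⟩ := exists_forall_Ioo_pos_flow (η := η) hx hc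
  obtain ⟨t, ht1, ht2⟩ := exists_between (lt_min hε h.1)
  exact h.mul_flow_nonpos ⟨ht1, ht2.trans_le (min_le_right _ _)⟩
    (hpos t ⟨ht1, ht2.trans_le (min_le_left _ _)⟩).2

/-! ### Geometry of the cylinder. -/

/-- Setting x₂ = 0 removes x₄ from H: the set is a planar cubic times a free x₄-line. -/
theorem mem_cylinder_iff {x : Fin 4 → ℝ} :
    x ∈ cylinder η ↔ x 1 = 0 ∧ x 2 ^ 2 = x 0 ^ 2 * (1 - 2 / 3 * x 0) := by
  simp only [cylinder, crossSection, energy, mem_inter_iff, mem_ofPred_eq]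
  refine and_congr_right fun h => ?_
  rw [h]
  constructor <;> intro h <;> linarith

/-- The points `(s, 0, c s √(1 - 2s/3), w)`, `c = ± 1`, lie on the cylinder. -/
theorem curve_mem_cylinder {s c w : ℝ} (hc : c ^ 2 = 1) (hs : s ≤ 3 / 2) :
    ![s, 0, c * (s * √(1 - 2 / 3 * s)), w] ∈ cylinder η := by
  rw [mem_cylinder_iff]
  refine ⟨rfl, ?_⟩
  simp only [Matrix.cons_val]
  rw [mul_pow, mul_pow, hc, Real.sq_sqrt (by linarith), one_mul]

/-- A point of the cylinder with `x₃ = 0` is a limit of points with `x₁ > 0`, `c x₃ > 0`. -/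
theorem mem_closure_of_cylinder {x : Fin 4 → ℝ} {c : ℝ} (hc : c ^ 2 = 1) (hx : x ∈ cylinder η)
    (hx2 : x 2 = 0) : x ∈ closure {y | y ∈ cylinder η ∧ 0 < y 0 ∧ 0 < c * y 2} := by
  set g : ℝ → Fin 4 → ℝ := fun s => ![s, 0, c * (s * √(1 - 2 / 3 * s)), x 3] with hg
  have hgc : Continuous g := by
    rw [continuous_pi_iff]
    intro i
    fin_cases i <;> simp [hg] <;> fun_prop
  have hmaps : MapsTo g (Ioo 0 (3 / 2)) {y | y ∈ cylinder η ∧ 0 < y 0 ∧ 0 < c * y 2} := by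
    intro s hs
    refine ⟨curve_mem_cylinder hc hs.2.le, hs.1, ?_⟩
    have : 0 < √(1 - 2 / 3 * s) := Real.sqrt_pos.2 (by linarith [hs.2])
    have : 0 < s * √(1 - 2 / 3 * s) := mul_pos hs.1 this
    simpa [hg, ← mul_assoc, ← sq, hc] using this
  obtain ⟨h1, h2⟩ := mem_cylinder_iff.1 hx
  have hx0 : x 0 = 0 ∨ x 0 = 3 / 2 := by
    rw [hx2] at h2
    rcases mul_eq_zero.1 (show x 0 ^ 2 * (1 - 2 / 3 * x 0) = 0 by linarith) with h | h
    · exact Or.inl (pow_eq_zero_iff two_ne_zero |>.1 h)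
    · right; linarith
  have hxg : x = g (x 0) := by
    ext i
    fin_cases i
    · rfl
    · exact h1
    · rcases hx0 with h | h <;> simp [hg, h, hx2]
    · rfl
  -- Both zeros of x₃ on the cubic are endpoints of the parameter interval of `g`.
  have hcl : x 0 ∈ closure (Ioo (0 : ℝ) (3 / 2)) := by
    rw [closure_Ioo (by norm_num)]
    rcases hx0 with h | h <;> rw [h] <;> constructor <;> norm_num
  rw [hxg]
  exact map_mem_closure hgc hcl hmaps

theorem mem_closure_C3_union_C4 {x : Fin 4 → ℝ} (hx : x ∈ cylinder η) (h2 : x 2 ≤ 0) :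
    x ∈ closure (C3 η ∪ C4 η) := by
  rcases h2.lt_or_eq with h | h
  · refine subset_closure ?_
    rcases lt_trichotomy (x 0) 0 with h0 | h0 | h0
    · exact Or.inr ⟨hx, h0, h⟩
    · have := (mem_cylinder_iff.1 hx).2
      rw [h0] at this
      nlinarith
    · exact Or.inl ⟨hx, h0, h⟩
  · refine closure_mono ?_ (mem_closure_of_cylinder (c := -1) (by norm_num) hx h)
    exact fun y hy => Or.inl ⟨hy.1, hy.2.1, by linarith [hy.2.2]⟩

theorem mem_closure_C1_union_C2 {x : Fin 4 → ℝ} (hx : x ∈ cylinder η) (h2 : 0 ≤ x 2) :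
    x ∈ closure (C1 η ∪ C2 η) := by
  rcases h2.lt_or_eq with h | h
  · refine subset_closure ?_
    rcases lt_trichotomy (x 0) 0 with h0 | h0 | h0
    · exact Or.inl ⟨hx, h0, h⟩
    · have := (mem_cylinder_iff.1 hx).2
      rw [h0] at this
      nlinarith
    · exact Or.inr ⟨hx, h0, h⟩
  · refine closure_mono ?_ (mem_closure_of_cylinder (c := 1) (by norm_num) hx h.symm)
    exact fun y hy => Or.inr ⟨hy.1, hy.2.1, by linarith [hy.2.2]⟩

/-! ### Energy, invariance and tangency on the local unstable manifold. -/

theorem zero_mem_localUnstable {U : Set (Fin 4 → ℝ)} (hU : 0 ∈ U) :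
    (0 : Fin 4 → ℝ) ∈ localUnstable η U := by
  have hc : ∀ t, IsIntegralCurveOn (fun _ => (0 : Fin 4 → ℝ)) (fun _ => field η) (uIcc 0 t) :=
    fun t s _ => by
      have : field η 0 = 0 := by ext i; fin_cases i <;> simp [field]
      simpa only [this] using hasDerivWithinAt_const s (uIcc 0 t) (0 : Fin 4 → ℝ)
  have hfl : ∀ t, flow η t 0 = 0 := fun t => flow_eq η t _ (hc t)
  refine ⟨fun t _ => ⟨⟨_, rfl, hc t⟩, by rwa [hfl t]⟩, ?_⟩
  simp only [hfl, tendsto_const_nhds]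

/-- H is constant along the backward orbit, which tends to the origin, where H = 0. -/
theorem energy_eq_zero_of_mem_localUnstable {U : Set (Fin 4 → ℝ)} {p : Fin 4 → ℝ}
    (hp : p ∈ localUnstable η U) : energy η p = 0 := by
  have hcont : Continuous (energy η) := by unfold energy; fun_prop
  have h1 : Tendsto (fun t => energy η (flow η t p)) atBot (𝓝 (energy η 0)) :=
    (hcont.tendsto 0).comp hp.2
  have h2 : Tendsto (fun t => energy η (flow η t p)) atBot (𝓝 (energy η p)) := by
    refine tendsto_const_nhds.congr' ?_
    filter_upwards [eventually_le_atBot 0] with t ht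
    exact (energy_flow (hp.1 t ht).1).symm
  rw [tendsto_nhds_unique h2 h1]
  simp [energy]

theorem flow_mem_localUnstable {U : Set (Fin 4 → ℝ)} {p : Fin 4 → ℝ} {s : ℝ}
    (hp : p ∈ localUnstable η U) (hs : s ≤ 0) : flow η s p ∈ localUnstable η U := by
  have key : ∀ t ≤ 0, t ∈ flowDomain η (flow η s p) ∧
      flow η t (flow η s p) = flow η (t + s) p := by
    intro t ht
    obtain ⟨γ, h0, hγ, hf⟩ := exists_solution (hp.1 (t + s) (by linarith)).1
    have hγ' : IsIntegralCurveOn (γ ∘ (· + s)) (fun _ => field η) (uIcc 0 t) := by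
      refine (hγ.comp_add s).mono fun u hu => ?_
      rw [mem_vadd_set_iff_neg_vadd_mem, neg_neg, vadd_eq_add, uIcc_of_ge (by linarith)]
      rw [uIcc_of_ge ht] at hu
      exact ⟨by linarith [hu.1], by linarith [hu.2]⟩
    have hs' : flow η s p = (γ ∘ (· + s)) 0 := by
      rw [hf s (by rw [uIcc_of_ge (by linarith)]; exact ⟨by linarith, hs⟩)]
      simp
    rw [hs', hf _ right_mem_uIcc]
    exact ⟨⟨_, rfl, hγ'⟩, flow_eq η t _ hγ'⟩
  refine ⟨fun t ht => ⟨(key t ht).1, ?_⟩, ?_⟩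
  · rw [(key t ht).2]
    exact (hp.1 (t + s) (by linarith)).2
  · refine (hp.2.comp (tendsto_atBot_add_const_right atBot s tendsto_id)).congr' ?_
    filter_upwards [eventually_le_atBot 0] with t ht
    exact (key t ht).2.symm

/-- If a backward invariant set lies in the graph `xᵢ = f (x₁, x₂)`, then the vector field is
tangent to that graph at the points of the set. -/
theorem field_eq_fderiv_of_mem_localUnstable {U : Set (Fin 4 → ℝ)} {f : ℝ × ℝ → ℝ} {i : Fin 4}
    {p : Fin 4 → ℝ} (hp : p ∈ localUnstable η U) (hf : DifferentiableAt ℝ f (p 0, p 1))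
    (h : ∀ q ∈ localUnstable η U, q i = f (q 0, q 1)) :
    field η p i = fderiv ℝ f (p 0, p 1) (p 1, p 2) := by
  obtain ⟨γ, h0, hγ, hfl⟩ := exists_solution (hp.1 (-1) (by norm_num)).1
  rw [uIcc_of_ge (by norm_num)] at hγ hfl
  have h0' : (0 : ℝ) ∈ Icc (-1 : ℝ) 0 := by constructor <;> norm_num
  have hd := fun j => IsIntegralCurveOn.hasDerivWithinAt_coord hγ h0' j
  have hpair := (hd 0).prodMk (hd 1)
  have hcomp := HasFDerivAt.comp_hasDerivWithinAt (f := fun u => (γ u 0, γ u 1)) (0 : ℝ)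
    (by simpa [h0] using hf.hasFDerivAt) hpair
  have heq : ∀ u ∈ Icc (-1 : ℝ) 0, γ u i = f (γ u 0, γ u 1) := fun u hu => by
    rw [← hfl u hu]
    exact h _ (flow_mem_localUnstable hp hu.2)
  -- Only the backward orbit is known to stay on the graph; the one-sided derivative at the endpoint
  -- 0 still determines the velocity.
  have := (uniqueDiffOn_Icc (by norm_num : (-1 : ℝ) < 0) 0 h0').eq_deriv _ (hd i)
    (hcomp.congr heq (heq 0 h0'))
  rw [h0] at this
  simpa [field] using this

/-! ### Linear part of the graph and the sign of `a`. -/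

variable {U : Set (Fin 4 → ℝ)} {V : Set (ℝ × ℝ)} {a b : ℝ × ℝ → ℝ}

theorem IsLocalUnstableGraph.mem_localUnstable (hab : IsLocalUnstableGraph η U V a b)
    {u : ℝ × ℝ} (hu : u ∈ V) : ![u.1, u.2, a u, b u] ∈ localUnstable η U := by
  rw [hab.localUnstable_eq]
  exact ⟨hu, rfl, rfl⟩

theorem IsLocalUnstableGraph.a_zero (hab : IsLocalUnstableGraph η U V a b) : a (0, 0) = 0 := by
  have h := zero_mem_localUnstable (η := η) hab.zero_mem_U
  rw [hab.localUnstable_eq] at h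
  exact h.2.1.symm

theorem IsLocalUnstableGraph.b_eq (hab : IsLocalUnstableGraph η U V a b) {u : ℝ × ℝ}
    (hu : u ∈ V) : b u = fderiv ℝ a u (u.2, a u) :=
  field_eq_fderiv_of_mem_localUnstable (i := 2) (hab.mem_localUnstable hu)
    (hab.analytic_a u hu).differentiableAt fun q hq => by
      rw [hab.localUnstable_eq] at hq; exact hq.2.1

theorem IsLocalUnstableGraph.field_eq (hab : IsLocalUnstableGraph η U V a b) {u : ℝ × ℝ}
    (hu : u ∈ V) : -u.1 + η * a u + u.1 ^ 2 = fderiv ℝ b u (u.2, a u) :=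
  field_eq_fderiv_of_mem_localUnstable (i := 3) (hab.mem_localUnstable hu)
    (hab.analytic_b u hu).differentiableAt fun q hq => by
      rw [hab.localUnstable_eq] at hq; exact hq.2.2

/-- In the product rule, the term with the second derivative of `f` is applied to g x = 0 and drops
out. -/
theorem hasFDerivAt_fderiv_apply {f : ℝ × ℝ → ℝ} {g : ℝ × ℝ → ℝ × ℝ} {x : ℝ × ℝ}
    {g' : ℝ × ℝ →L[ℝ] ℝ × ℝ} (hf : AnalyticAt ℝ f x) (hg : HasFDerivAt g g' x) (hx : g x = 0) :
    HasFDerivAt (fun u => fderiv ℝ f u (g u)) ((fderiv ℝ f x).comp g') x := by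
  convert! hf.fderiv.differentiableAt.hasFDerivAt.clm_apply hg using 1
  ext <;> simp [hx]

/-- The slope at the origin of the local unstable manifold: `∂a/∂x₁ (0, 0) = -1`. -/
theorem IsLocalUnstableGraph.fderiv_a (hη : η ∈ Ioo (-2 : ℝ) 2)
    (hab : IsLocalUnstableGraph η U V a b) : fderiv ℝ a (0, 0) (1, 0) = -1 := by
  have ha := hab.analytic_a _ hab.zero_mem_V
  have hb := hab.analytic_b _ hab.zero_mem_V
  have hV := hab.isOpen_V.mem_nhds hab.zero_mem_V
  have ha' := ha.differentiableAt.hasFDerivAt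
  have hb' := hb.differentiableAt.hasFDerivAt
  have hg : HasFDerivAt (fun u : ℝ × ℝ => (u.2, a u)) _ (0, 0) := hasFDerivAt_snd.prodMk ha'
  have hg0 : (fun u : ℝ × ℝ => (u.2, a u)) (0, 0) = 0 := by simp [hab.a_zero]
  have e1 := hb'.unique ((hasFDerivAt_fderiv_apply ha hg hg0).congr_of_eventuallyEq
    (by filter_upwards [hV] with u hu using hab.b_eq hu))
  have e2 := (((hasFDerivAt_fst (𝕜 := ℝ) (p := ((0, 0) : ℝ × ℝ))).neg.add (ha'.const_mul η)).add
    ((hasFDerivAt_fst (𝕜 := ℝ) (p := ((0, 0) : ℝ × ℝ))).pow 2)).unique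
    ((hasFDerivAt_fderiv_apply hb hg hg0).congr_of_eventuallyEq
    (by filter_upwards [hV] with u hu using hab.field_eq hu))
  set A := fderiv ℝ a (0, 0)
  set B := fderiv ℝ b (0, 0)
  have hA : ∀ x y : ℝ, A (x, y) = x * A (1, 0) + y * A (0, 1) := fun x y => by
    rw [← smul_eq_mul, ← smul_eq_mul, ← map_smul, ← map_smul, ← map_add]; simp
  have hB : ∀ x y : ℝ, B (x, y) = x * B (1, 0) + y * B (0, 1) := fun x y => by
    rw [← smul_eq_mul, ← smul_eq_mul, ← map_smul, ← map_smul, ← map_add]; simp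
  have p1 := DFunLike.congr_fun e1 (1, 0)
  have p2 := DFunLike.congr_fun e1 (0, 1)
  have q1 := DFunLike.congr_fun e2 (1, 0)
  have q2 := DFunLike.congr_fun e2 (0, 1)
  simp at p1 p2 q1 q2
  rw [hA] at p1 p2
  rw [hB] at q1 q2
  generalize A (1, 0) = α at *
  generalize A (0, 1) = β at *
  rw [p1, p2] at q1 q2
  -- With α, β the partials of `a`, `q1` and `q2` now read -1 + ηα = α(α + β²) and ηβ = β(2α + β²).
  have h1 : β * (η - 2 * α - β ^ 2) = 0 := by linarith
  rcases mul_eq_zero.1 h1 with h | h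
  · rw [h] at q1
    -- For β = 0, α² - ηα + 1 = 0 has discriminant η² - 4 < 0.
    nlinarith [sq_nonneg (2 * α - η), mul_pos (sub_pos.2 hη.1) (sub_pos.2 hη.2)]
  · have hη' : η = 2 * α + β ^ 2 := by linarith
    rw [hη'] at q1
    rcases sq_eq_sq_iff_eq_or_eq_neg.1 (show α ^ 2 = 1 ^ 2 by linarith) with h' | h'
    -- The root α = 1 would force η = 2 + β² ≥ 2.
    · have := hη.2
      nlinarith [sq_nonneg β]
    · exact h'

theorem IsLocalUnstableGraph.exists_forall_sign (hη : η ∈ Ioo (-2 : ℝ) 2)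
    (hab : IsLocalUnstableGraph η U V a b) :
    ∃ r₀ > 0, ∀ r ∈ Ioo 0 r₀, ((-r, 0) ∈ V ∧ 0 < a (-r, 0)) ∧ ((r, 0) ∈ V ∧ a (r, 0) < 0) := by
  have hl : HasDerivAt (fun s : ℝ => ((s, 0) : ℝ × ℝ)) (1, 0) 0 :=
    (hasDerivAt_id (0 : ℝ)).prodMk (hasDerivAt_const _ _)
  have hV : ∀ᶠ s : ℝ in 𝓝 0, ((s, 0) : ℝ × ℝ) ∈ V :=
    hl.continuousAt.eventually_mem (hab.isOpen_V.mem_nhds hab.zero_mem_V)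
  have hd := (HasFDerivAt.comp_hasDerivAt (f := fun s : ℝ => ((s, 0) : ℝ × ℝ)) (0 : ℝ)
    (hab.analytic_a _ hab.zero_mem_V).differentiableAt.hasFDerivAt hl).neg
  rw [hab.fderiv_a hη, neg_neg] at hd
  have h0 : (-(a ∘ fun s : ℝ => ((s, 0) : ℝ × ℝ))) 0 = 0 := by simp [hab.a_zero]
  have hR := HasDerivWithinAt.eventually_pos_right hd.hasDerivWithinAt h0 one_pos
  have hL := HasDerivWithinAt.eventually_neg_left hd.hasDerivWithinAt h0 one_pos
  rw [eventually_nhdsWithin_iff] at hR hL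
  obtain ⟨r₀, hr₀, h⟩ := Metric.eventually_nhds_iff.1 (hV.and (hR.and hL))
  refine ⟨r₀, hr₀, fun r hr => ⟨?_, ?_⟩⟩
  · have := h (y := -r) (by simpa [abs_of_pos hr.1] using hr.2)
    exact ⟨this.1, by simpa using this.2.2 (by simpa using hr.1)⟩
  · have := h (y := r) (by simpa [abs_of_pos hr.1] using hr.2)
    exact ⟨this.1, by simpa using this.2.1 hr.1⟩

theorem IsLocalUnstableGraph.exists_forall_sigma_mem (hη : η ∈ Ioo (-2 : ℝ) 2)
    (hab : IsLocalUnstableGraph η U V a b) :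
    ∃ r₀ > 0, ∀ r ∈ Ioo 0 r₀, sigma a b r Real.pi ∈ C1 η ∧ sigma a b r (2 * Real.pi) ∈ C3 η := by
  obtain ⟨r₀, hr₀, h⟩ := hab.exists_forall_sign hη
  refine ⟨r₀, hr₀, fun r hr => ?_⟩
  obtain ⟨⟨hV1, h1⟩, hV2, h2⟩ := h r hr
  have e1 : sigma a b r Real.pi = ![-r, 0, a (-r, 0), b (-r, 0)] := by simp [sigma]
  have e2 : sigma a b r (2 * Real.pi) = ![r, 0, a (r, 0), b (r, 0)] := by simp [sigma]
  rw [e1, e2]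
  exact ⟨⟨⟨rfl, energy_eq_zero_of_mem_localUnstable (hab.mem_localUnstable hV1)⟩,
      neg_lt_zero.2 hr.1, h1⟩,
    ⟨rfl, energy_eq_zero_of_mem_localUnstable (hab.mem_localUnstable hV2)⟩, hr.1, h2⟩

end BifocalSystem

/-! ### The four statements. -/

theorem mainTheorem2 (η : ℝ) (hη : η ∈ Set.Ioo (-2 : ℝ) 2)
    (U : Set (Fin 4 → ℝ)) (V : Set (ℝ × ℝ)) (a b : ℝ × ℝ → ℝ)
    (hab : BifocalSystem.IsLocalUnstableGraph η U V a b) :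
    (∃ r₀ > 0, ∀ r ∈ Set.Ioo 0 r₀,
      BifocalSystem.sigma a b r Real.pi ∈ BifocalSystem.C1 η ∧
      BifocalSystem.sigma a b r (2 * Real.pi) ∈ BifocalSystem.C3 η) ∧
    (∃ r₀ > 0, ∀ r ∈ Set.Ioo 0 r₀, ∃ ε > 0, ∀ t ∈ Set.Ioo 0 ε,
      (t ∈ BifocalSystem.flowDomain η (BifocalSystem.sigma a b r Real.pi) ∧
        0 < BifocalSystem.flow η t (BifocalSystem.sigma a b r Real.pi) 1) ∧
      (t ∈ BifocalSystem.flowDomain η (BifocalSystem.sigma a b r (2 * Real.pi)) ∧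
        BifocalSystem.flow η t (BifocalSystem.sigma a b r (2 * Real.pi)) 1 < 0)) ∧
    (∀ (x : Fin 4 → ℝ) (τ : ℝ), BifocalSystem.energy η x = 0 →
      BifocalSystem.IsFirstHit η x τ →
      (0 < x 1 → BifocalSystem.flow η τ x ∈
        closure (BifocalSystem.C3 η ∪ BifocalSystem.C4 η)) ∧
      (x 1 < 0 → BifocalSystem.flow η τ x ∈
        closure (BifocalSystem.C1 η ∪ BifocalSystem.C2 η))) ∧
    (∀ r > 0, (∀ θ : ℝ, (r * Real.cos θ, r * Real.sin θ) ∈ V) →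
      ∀ k : ℕ, 1 ≤ k → ∀ x ∈ BifocalSystem.sectionAll η a b r k,
      ∀ τ : ℝ, BifocalSystem.IsFirstHit η x τ →
      BifocalSystem.flow η τ x ∈ BifocalSystem.sectionAll η a b r (k + 1) →
      (x ∈ BifocalSystem.C1 η ∪ BifocalSystem.C2 η →
        BifocalSystem.flow η τ x ∈ closure (BifocalSystem.C3 η ∪ BifocalSystem.C4 η)) ∧
      (x ∈ BifocalSystem.C3 η ∪ BifocalSystem.C4 η →
        BifocalSystem.flow η τ x ∈ closure (BifocalSystem.C1 η ∪ BifocalSystem.C2 η))) := by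
  obtain ⟨r₀, hr₀, hσ⟩ := hab.exists_forall_sigma_mem hη
  refine ⟨⟨r₀, hr₀, hσ⟩, ⟨r₀, hr₀, fun r hr => ?_⟩, fun x τ hx h => ⟨fun hx1 => ?_, fun hx1 => ?_⟩,
    fun r _ _ k _ x _ τ h _ => ⟨fun hx => ?_, fun hx => ?_⟩⟩
  · obtain ⟨h1, h2⟩ := hσ r hr
    obtain ⟨ε₁, hε₁, H1⟩ := BifocalSystem.exists_forall_Ioo_pos_flow (η := η) (c := 1) h1.1.1
      (by linarith [h1.2.2])
    obtain ⟨ε₂, hε₂, H2⟩ := BifocalSystem.exists_forall_Ioo_pos_flow (η := η) (c := -1) h2.1.1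
      (by linarith [h2.2.2])
    refine ⟨min ε₁ ε₂, lt_min hε₁ hε₂, fun t ht => ⟨?_, ?_⟩⟩
    · obtain ⟨hd, hp⟩ := H1 t ⟨ht.1, ht.2.trans_le (min_le_left _ _)⟩
      exact ⟨hd, by linarith⟩
    · obtain ⟨hd, hp⟩ := H2 t ⟨ht.1, ht.2.trans_le (min_le_right _ _)⟩
      exact ⟨hd, by linarith⟩
  · exact BifocalSystem.mem_closure_C3_union_C4 (h.flow_mem_cylinder hx)
      (by linarith [h.mul_flow_nonpos_of_pos (c := 1) (by linarith)])
  · exact BifocalSystem.mem_closure_C1_union_C2 (h.flow_mem_cylinder hx)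
      (by linarith [h.mul_flow_nonpos_of_pos (c := -1) (by linarith)])
  · have hx' : x ∈ BifocalSystem.cylinder η ∧ 0 < x 2 := by
      rcases hx with hx | hx <;> exact ⟨hx.1, hx.2.2⟩
    exact BifocalSystem.mem_closure_C3_union_C4 (h.flow_mem_cylinder hx'.1.2)
      (by linarith [h.mul_flow_nonpos_of_mem (c := 1) hx'.1.1 (by linarith)])
  · have hx' : x ∈ BifocalSystem.cylinder η ∧ x 2 < 0 := by
      rcases hx with hx | hx <;> exact ⟨hx.1, hx.2.2⟩
    exact BifocalSystem.mem_closure_C1_union_C2 (h.flow_mem_cylinder hx'.1.2)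
      (by linarith [h.mul_flow_nonpos_of_mem (c := -1) hx'.1.1 (by linarith)])
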